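/- Let $V\subset\mathbb{R}^n$ be a finite set containing no two distinct parallel vectors, where $u,v$ are called parallel if $u=rv$ for some real $r\neq 0$ (of either sign). Let $P(V)=\{\sum_{v\in W}v : W\subseteq V\}$. Let $T\subset\mathbb{R}^n$ be a closed set that is $V$-closed, meaning that for every $t\in T$ and every $v\in V$, either $t+v\in T$ or $t-v\in T$ (or both). Let $C=\operatorname{cl}\operatorname{conv}T$ be the closure of the convex hull of $T$, and let $x$ be an extreme point of $C$. Then there is $t\in\mathbb{R}^n$ with $x\in t+P(V)\subseteq C$. -/

import Mathlib

namespace VClosed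

/-- Two vectors are parallel if each is a nonzero real multiple of the other
(the multiple may be negative, so opposite directions count as parallel). -/
def Parallel {n : ℕ} (u v : EuclideanSpace ℝ (Fin n)) : Prop :=
  ∃ r : ℝ, r ≠ 0 ∧ u = r • v

/-- `T` is `V`-closed: for all `t ∈ T` and `v ∈ V`, either `t + v ∈ T` or `t - v ∈ T`. -/
def IsVClosed {n : ℕ} (V : Finset (EuclideanSpace ℝ (Fin n)))
    (T : Set (EuclideanSpace ℝ (Fin n))) : Prop :=
  ∀ t ∈ T, ∀ v ∈ V, t + v ∈ T ∨ t - v ∈ T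

/-- The set `P(V)` of all sums `∑ v ∈ W, v` with `W ⊆ V`. -/
def subsetSums {n : ℕ} (V : Finset (EuclideanSpace ℝ (Fin n))) :
    Set (EuclideanSpace ℝ (Fin n)) :=
  {p | ∃ W : Finset (EuclideanSpace ℝ (Fin n)), W ⊆ V ∧ p = ∑ v ∈ W, v}

/-- The translate `t + P` of the set `P` by the vector `t`. -/
def translate {n : ℕ} (t : EuclideanSpace ℝ (Fin n)) (P : Set (EuclideanSpace ℝ (Fin n))) :
    Set (EuclideanSpace ℝ (Fin n)) :=
  (fun p => t + p) '' P

end VClosed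

/-! The extreme point `x` lies in `T`, so each `v` has a sign with `x + a v ∈ C`, where `a v = ±v`.
The translate through `x` determined by these signs consists of `x` plus subsums of the `a v`, and
it remains to keep these in `C` (`add_sum_mem_closure_convexHull`). If such a sum left `C`, a
functional `g` would separate it; only terms with `g (a v) > 0` matter. Extremality gives `f`
bounded below on `C` but huge on these `a v` (`exists_strongDual_steep_generic`). Then `(f, g)` maps
`T` to a planar set closed under nearly horizontal steps. Its support function is convex, with a
kink of at least `g (a v)` at `f (a v) / g (a v)`, while its final slope is at most the height of
the set. Nonparallel vectors allow distinct kink positions, so the kinks add up and contradict the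
separation (`sum_le_of_forall_add_mem_or_sub_mem`). -/

/-! ### Planar estimate through kinks of a support function. -/

section PlanarEstimate

open Finset

/-- A convex function on `[0, ∞)` whose second differences at the points `p i` are at least
`δ * w i` has slope at least the sum of all the `w i` to the right of all the `p i`. -/
theorem ConvexOn.sum_jumps_mul_le {ι : Type*} {h : ℝ → ℝ} (hc : ConvexOn ℝ (Set.Ici 0) h)
    (hpos : ∀ s, 0 ≤ s → 0 ≤ h s) {B c : ℝ} (hB : h 0 ≤ B) (hc0 : 0 < c)
    (p w : ι → ℝ) (I : Finset ι) (hinj : Set.InjOn p I) (hcp : ∀ i ∈ I, c < p i)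
    (hjump : ∀ i ∈ I, ∀ δ, 0 < δ → δ ≤ p i → 2 * h (p i) + δ * w i ≤ h (p i - δ) + h (p i + δ)) :
    ∀ a b, c ≤ a → a < b → (∀ i ∈ I, p i ≤ a) →
      (b - a) * (∑ i ∈ I, w i - B / c) ≤ h b - h a := by
  classical
  have hB0 : 0 ≤ B := (hpos 0 le_rfl).trans hB
  induction I using Finset.induction_on_max_value p with
  | empty =>
    intro a b hca hab _
    have ha : 0 < a := hc0.trans_le hca
    have h1 := hc.slope_mono_adjacent (x := 0) (y := a) (z := b) (by simp)
      (Set.mem_Ici.2 (ha.trans hab).le) ha hab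
    -- Since `h` falls from at most `B` to a nonnegative value, its chord over `[0, a]` has slope at
    -- least `-B / a`.
    have h2 : -(B / c) ≤ (h a - h 0) / (a - 0) := by
      have e1 : B / a ≤ B / c := by gcongr
      have e2 : -(B / a) ≤ (h a - h 0) / (a - 0) := by
        rw [sub_zero, ← neg_div]
        gcongr
        linarith [hpos a ha.le]
      linarith
    have h3 := h2.trans h1
    rw [le_div_iff₀ (by linarith)] at h3
    simp only [sum_empty]
    linarith
  | insert j s hj hmax ih =>
    intro a b hca hab hle
    have hsub : (s : Set ι) ⊆ (insert j s : Finset ι) := by simp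
    have hlt : ∀ i ∈ s, p i < p j := fun i hi => lt_of_le_of_ne (hmax i hi) fun e =>
      hj ((hinj (mem_insert_of_mem hi) (mem_insert_self j s) e) ▸ hi)
    have hjc := hcp j (mem_insert_self j s)
    have hja := hle j (mem_insert_self j s)
    -- a left neighbour `p j - δ` still to the right of the earlier points
    obtain ⟨m, hcm, hmj, hm⟩ : ∃ m, c ≤ m ∧ m < p j ∧ ∀ i ∈ s, p i ≤ m := by
      rcases s.eq_empty_or_nonempty with rfl | hne
      · exact ⟨c, le_rfl, hjc, by simp⟩
      · obtain ⟨i, hi, hi'⟩ := s.exists_max_image p hne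
        exact ⟨p i, (hcp i (mem_insert_of_mem hi)).le, hlt i hi, hi'⟩
    set δ := min (p j - m) (b - a) with hδ
    have hδ0 : 0 < δ := lt_min (by linarith) (by linarith)
    have hδ1 : δ ≤ p j - m := min_le_left _ _
    have hδ2 : δ ≤ b - a := min_le_right _ _
    have h1 := ih (hinj.mono hsub) (fun i hi => hcp i (mem_insert_of_mem hi))
      (fun i hi => hjump i (mem_insert_of_mem hi)) (p j - δ) (p j) (by linarith) (by linarith)
      (fun i hi => (hm i hi).trans (by linarith))
    have h2 := hjump j (mem_insert_self j s) δ hδ0 (by linarith)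
    -- The slope just left of `p j` comes from induction, and the kink adds `w j`. Convexity then
    -- carries the bound to `[p j, b]` and on to `[a, b]`.
    have h3 : (∑ i ∈ insert j s, w i - B / c) ≤ (h (p j + δ) - h (p j)) / (p j + δ - p j) := by
      rw [le_div_iff₀ (by linarith), sum_insert hj]
      linarith
    have m1 : p j ∈ Set.Ici (0 : ℝ) := Set.mem_Ici.2 (by linarith)
    have m2 : p j + δ ∈ Set.Ici (0 : ℝ) := Set.mem_Ici.2 (by linarith)
    have m3 : b ∈ Set.Ici (0 : ℝ) := Set.mem_Ici.2 (by linarith)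
    have m4 : a ∈ Set.Ici (0 : ℝ) := Set.mem_Ici.2 (by linarith)
    have h4 := hc.secant_mono m1 m2 m3 (by linarith) (by linarith) (by linarith : p j + δ ≤ b)
    have h5 := hc.secant_mono m3 m1 m4 (by linarith) (by linarith) hja
    rw [← neg_div_neg_eq, neg_sub, neg_sub, ← neg_div_neg_eq (h a - h b), neg_sub, neg_sub] at h5
    have h6 := (h3.trans h4).trans h5
    rw [le_div_iff₀ (by linarith)] at h6
    linarith

/-- If a planar set contains the origin, is bounded to the left and above, and contains with every
point one of the two translates by `±(α i, β i)`, where the vectors `(α i, β i)` lie in the open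
first quadrant, have distinct slopes and are nearly horizontal, then its height is at least
nearly `∑ i, β i`. -/
theorem sum_le_of_forall_add_mem_or_sub_mem {ι : Type*} {P : Set (ℝ × ℝ)} (h0 : (0, 0) ∈ P)
    {B M c : ℝ} (hB : ∀ p ∈ P, -B ≤ p.1) (hM : ∀ p ∈ P, p.2 ≤ M) (hc : 0 < c)
    (α β : ι → ℝ) (I : Finset ι) (hβ : ∀ i ∈ I, 0 < β i) (hcI : ∀ i ∈ I, c < α i / β i)
    (hinj : Set.InjOn (fun i => α i / β i) I)
    (hP : ∀ p ∈ P, ∀ i ∈ I, p + (α i, β i) ∈ P ∨ p - (α i, β i) ∈ P) :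
    ∑ i ∈ I, β i ≤ M + B / c := by
  set φ : ℝ → ℝ × ℝ → ℝ := fun s p => s * p.2 - p.1 with hφ
  set h : ℝ → ℝ := fun s => sSup (φ s '' P) with hh
  have hup : ∀ s, 0 ≤ s → ∀ p ∈ P, φ s p ≤ s * M + B := fun s hs p hp => by
    have := mul_le_mul_of_nonneg_left (hM p hp) hs
    have := hB p hp
    simp only [hφ]
    linarith
  have hbdd : ∀ s, 0 ≤ s → BddAbove (φ s '' P) := fun s hs =>
    ⟨s * M + B, by rintro _ ⟨p, hp, rfl⟩; exact hup s hs p hp⟩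
  have hne : ∀ s, (φ s '' P).Nonempty := fun s => ⟨_, _, h0, rfl⟩
  have hle : ∀ s, 0 ≤ s → ∀ p ∈ P, φ s p ≤ h s := fun s hs p hp =>
    le_csSup (hbdd s hs) ⟨p, hp, rfl⟩
  have hhup : ∀ s, 0 ≤ s → h s ≤ s * M + B := fun s hs =>
    csSup_le (hne s) (by rintro _ ⟨p, hp, rfl⟩; exact hup s hs p hp)
  have hpos : ∀ s, 0 ≤ s → 0 ≤ h s := fun s hs => by simpa [hφ] using hle s hs _ h0
  have hconv : ConvexOn ℝ (Set.Ici 0) h := by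
    refine ⟨convex_Ici 0, fun a ha b hb u v hu hv huv => ?_⟩
    refine csSup_le (hne _) ?_
    rintro _ ⟨p, hp, rfl⟩
    have e1 := mul_le_mul_of_nonneg_left (hle a ha p hp) hu
    have e2 := mul_le_mul_of_nonneg_left (hle b hb p hp) hv
    have e3 : φ (u • a + v • b) p = u * φ a p + v * φ b p := by
      simp only [hφ, smul_eq_mul]
      linear_combination p.1 * huv
    rw [e3, smul_eq_mul, smul_eq_mul]
    linarith
  have hjump : ∀ i ∈ I, ∀ δ, 0 < δ → δ ≤ α i / β i →
      2 * h (α i / β i) + δ * β i ≤ h (α i / β i - δ) + h (α i / β i + δ) := by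
    intro i hi δ hδ hδi
    have hb := hβ i hi
    have hs0 : 0 < α i / β i := hc.trans (hcI i hi)
    have hαs : α i = α i / β i * β i := by field_simp
    set s := α i / β i with hs
    refine le_of_forall_pos_le_add fun ε hε => ?_
    obtain ⟨_, ⟨t, ht, rfl⟩, htε⟩ := exists_lt_of_lt_csSup (hne s)
      (show h s - ε / 2 < sSup (φ s '' P) by simp only [hh]; linarith)
    -- both ends of a translate of `(α i, β i)` nearly maximize `φ s`
    obtain ⟨q, hq, hq', hφq⟩ : ∃ q ∈ P, q + (α i, β i) ∈ P ∧ φ s q = φ s t := by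
      rcases hP t ht i hi with h1 | h1
      · exact ⟨t, ht, h1, rfl⟩
      · refine ⟨_, h1, by simpa using ht, ?_⟩
        simp only [hφ, Prod.fst_sub, Prod.snd_sub]
        linear_combination hαs
    have e1 := hle (s - δ) (by linarith) q hq
    have e2 := hle (s + δ) (by linarith) _ hq'
    simp only [hφ, Prod.fst_add, Prod.snd_add] at e1 e2 hφq htε
    nlinarith
  have hslope := hconv.sum_jumps_mul_le hpos (B := B) (by simpa using hhup 0 le_rfl) hc
    (fun i => α i / β i) β I hinj hcI hjump
  obtain ⟨a, hca, ha⟩ : ∃ a, c ≤ a ∧ ∀ i ∈ I, α i / β i ≤ a := by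
    obtain ⟨a, ha⟩ := (I.image fun i => α i / β i).bddAbove
    exact ⟨max a c, le_max_right _ _, fun i hi =>
      (ha (by simpa using ⟨i, hi, rfl⟩)).trans (le_max_left _ _)⟩
  by_contra! hlt
  -- Beyond `a` the slope of `h` is at least `M + D`, yet `h s ≤ s * M + B`. A run longer than `k`
  -- exhausts the slack `B + a * M`.
  set D := ∑ i ∈ I, β i - B / c - M with hD
  have hD0 : 0 < D := by linarith
  have ha0 : 0 < a := hc.trans_le hca
  set k := (B + a * M) / D with hk
  have hkD : k * D = B + a * M := div_mul_cancel₀ _ hD0.ne'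
  have hb : a < a + |k| + 1 := by linarith [abs_nonneg k]
  have e1 := hslope a (a + |k| + 1) hca hb ha
  have e2 := hhup (a + |k| + 1) (by linarith)
  have e3 := hpos a ha0.le
  have e4 : k * D ≤ |k| * D := mul_le_mul_of_nonneg_right (le_abs_self k) hD0.le
  have e5 : (a + |k| + 1 - a) * (∑ i ∈ I, β i - B / c) = (|k| + 1) * D + (|k| + 1) * M := by
    rw [hD]; ring
  nlinarith

end PlanarEstimate

/-! ### Functionals adapted to an extreme point. -/

section ExtremePoints

open Set Filter Topology

variable {E : Type*} [NormedAddCommGroup E] [NormedSpace ℝ E]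

theorem IsCompact.convexJoin {s t : Set E} (hs : IsCompact s) (ht : IsCompact t) :
    IsCompact (_root_.convexJoin ℝ s t) := by
  have : _root_.convexJoin ℝ s t =
      (fun p : E × E × ℝ => (1 - p.2.2) • p.1 + p.2.2 • p.2.1) '' (s ×ˢ t ×ˢ Icc (0 : ℝ) 1) := by
    ext x
    simp only [mem_convexJoin, segment_eq_image, mem_image, Prod.exists, mem_prod]
    constructor
    · rintro ⟨a, ha, b, hb, θ, hθ, rfl⟩
      exact ⟨a, b, θ, ⟨ha, hb, hθ⟩, rfl⟩
    · rintro ⟨a, b, θ, ⟨ha, hb, hθ⟩, rfl⟩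
      exact ⟨a, ha, b, hb, θ, hθ, rfl⟩
  rw [this]
  exact (hs.prod (ht.prod isCompact_Icc)).image (by fun_prop)

theorem convexHull_finset_subset_iterate_convexJoin {s : Set E} (k : ℕ) :
    ∀ t : Finset E, ↑t ⊆ s → t.card = k + 1 →
      convexHull ℝ (t : Set E) ⊆ (convexJoin ℝ s)^[k] s := by
  classical
  induction k with
  | zero =>
    intro t hts ht
    obtain ⟨a, rfl⟩ := Finset.card_eq_one.1 ht
    simpa using hts
  | succ k ih =>
    intro t hts ht
    obtain ⟨a, t', ha, rfl, ht'⟩ := Finset.card_eq_succ.1 ht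
    rw [Finset.coe_insert, insert_subset_iff] at hts
    rw [Finset.coe_insert, convexHull_insert (by
      simpa using Finset.card_pos.1 (by omega : 0 < t'.card)), Function.iterate_succ_apply']
    exact convexJoin_mono (by simpa using hts.1) (ih t' hts.2 ht')

/-- By Carathéodory the hull is a finite union of iterated joins of `s`, each of them compact. -/
theorem IsCompact.convexHull_of_finiteDimensional [FiniteDimensional ℝ E] {s : Set E}
    (hs : IsCompact s) : IsCompact (convexHull ℝ s) := by
  have hK : ∀ k, IsCompact ((_root_.convexJoin ℝ s)^[k] s) := by
    intro k
    induction k with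
    | zero => simpa using hs
    | succ k ih => rw [Function.iterate_succ_apply']; exact hs.convexJoin ih
  have hsub : ∀ k, (_root_.convexJoin ℝ s)^[k] s ⊆ convexHull ℝ s := by
    intro k
    induction k with
    | zero => simpa using subset_convexHull ℝ s
    | succ k ih =>
      rw [Function.iterate_succ_apply']
      exact convexJoin_subset (subset_convexHull ℝ s) ih (convex_convexHull ℝ s)
  have : convexHull ℝ s =
      ⋃ k ∈ Finset.range (Module.finrank ℝ E + 1), (_root_.convexJoin ℝ s)^[k] s := by
    refine Subset.antisymm ?_ (iUnion₂_subset fun k _ => hsub k)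
    rw [convexHull_eq_union]
    refine iUnion_subset fun t => iUnion₂_subset fun hts hind => ?_
    rcases t.eq_empty_or_nonempty with rfl | hne
    · simp
    have hcard : t.card ≤ Module.finrank ℝ E + 1 := by
      simpa using hind.card_le_finrank_succ.trans
        (Nat.add_le_add_right (Submodule.finrank_le _) 1)
    have hpos := hne.card_pos
    refine (convexHull_finset_subset_iterate_convexJoin (t.card - 1) t hts (by omega)).trans ?_
    exact subset_biUnion_of_mem (u := fun k => (_root_.convexJoin ℝ s)^[k] s)
      (by simp only [Finset.coe_range, mem_Iio]; omega : t.card - 1 ∈ _)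
  rw [this]
  exact Finset.isCompact_biUnion _ fun k _ => hK k

theorem notMem_convexHull_of_mem_extremePoints {C D : Set E} {x : E} (hC : Convex ℝ C)
    (hx : x ∈ extremePoints ℝ C) (hD : D ⊆ C) (hxD : x ∉ D) : x ∉ convexHull ℝ D := fun h =>
  hxD (extremePoints_convexHull_subset
    (inter_extremePoints_subset_extremePoints_of_subset (convexHull_min hD hC) ⟨h, hx⟩))

/-- A lower bound for a linear functional on a sphere about a point of a convex set extends to
the outside of the sphere. -/
theorem Convex.le_of_le_on_sphere {C : Set E} {x : E} (hC : Convex ℝ C) (hx : x ∈ C)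
    (f : StrongDual ℝ E) {r δ : ℝ} (hr : 0 < r) (hδ : 0 ≤ δ)
    (hf : ∀ c ∈ C, ‖c - x‖ = r → f x + δ ≤ f c) {c : E} (hc : c ∈ C) (hcr : r ≤ ‖c - x‖) :
    f x + δ ≤ f c := by
  set ρ := ‖c - x‖ with hρ
  have hρ0 : 0 < ρ := hr.trans_le hcr
  have hd := hC.add_smul_sub_mem hx hc (t := r / ρ) ⟨by positivity, (div_le_one hρ0).2 hcr⟩
  have h1 := hf _ hd (by
    rw [add_sub_cancel_left, norm_smul, ← hρ, Real.norm_of_nonneg (by positivity)]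
    field_simp)
  simp only [map_add, map_smul, map_sub, smul_eq_mul] at h1
  have h2 : δ ≤ r / ρ * (f c - f x) := by linarith
  have h3 : r / ρ ≤ 1 := (div_le_one hρ0).2 hcr
  have h4 : 0 < r / ρ := by positivity
  by_contra! h
  rcases le_or_gt (f c - f x) 0 with h5 | h5
  · have := mul_nonpos_of_nonneg_of_nonpos h4.le h5
    nlinarith
  · nlinarith

/-- Slices of a closed convex set by halfspaces isolate an extreme point. -/
theorem exists_strongDual_slice [FiniteDimensional ℝ E] {C : Set E} {x : E} (hC : Convex ℝ C)
    (hCc : IsClosed C) (hx : x ∈ extremePoints ℝ C) {r : ℝ} (hr : 0 < r) :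
    ∃ f : StrongDual ℝ E, ∃ δ > 0, ∀ c ∈ C, r ≤ ‖c - x‖ → f x + δ ≤ f c := by
  have := FiniteDimensional.proper ℝ E
  set D := C ∩ Metric.sphere x r with hD
  have hDc : IsCompact (convexHull ℝ D) :=
    ((isCompact_sphere x r).inter_left hCc).convexHull_of_finiteDimensional
  have hxD : x ∉ D := fun h => by
    have := h.2
    simp only [mem_sphere_iff_norm, sub_self, norm_zero] at this
    linarith
  obtain ⟨f, u, hu, hf⟩ := geometric_hahn_banach_point_closed (convex_convexHull ℝ D)
    hDc.isClosed (notMem_convexHull_of_mem_extremePoints hC hx inter_subset_left hxD)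
  refine ⟨f, u - f x, by linarith, fun c hc hcr => ?_⟩
  refine hC.le_of_le_on_sphere hx.1 f hr (by linarith) (fun d hd hdr => ?_) hc hcr
  have := hf d (subset_convexHull ℝ D ⟨hd, by rwa [mem_sphere_iff_norm]⟩)
  linarith

/-- If a ball about `x` missed `T`, a slice at `x` would put `T`, hence its closed hull, in a
halfspace excluding `x`. -/
theorem extremePoints_closure_convexHull_subset [FiniteDimensional ℝ E] {T : Set E}
    (hT : IsClosed T) : extremePoints ℝ (closure (convexHull ℝ T)) ⊆ T := by
  intro x hx
  by_contra hxT
  obtain ⟨r, hr, hball⟩ := Metric.isOpen_iff.1 hT.isOpen_compl x hxT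
  obtain ⟨f, δ, hδ, hf⟩ := exists_strongDual_slice (convex_convexHull ℝ T).closure
    isClosed_closure hx hr
  have hsub : closure (convexHull ℝ T) ⊆ {c | f x + δ ≤ f c} := by
    refine closure_minimal (convexHull_min (fun t ht => ?_) ?_)
      (isClosed_le continuous_const f.continuous)
    · refine hf t (subset_closure (subset_convexHull ℝ T ht)) ?_
      by_contra! h
      exact hball (by rwa [mem_ball_iff_norm]) ht
    · exact convex_halfSpace_ge f.toLinearMap.isLinear _
  have : f x + δ ≤ f x := hsub hx.1
  linarith

/-- At an extreme point `x` of a closed convex set there is a functional which is much larger on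
finitely many given nonzero directions into the set than its oscillation below `x`. -/
theorem exists_strongDual_steep {C : Set E} {x : E} (hC : Convex ℝ C)
    (hCc : IsClosed C) (hx : x ∈ extremePoints ℝ C) {A : Set E} (hA : A.Finite)
    (hA0 : ∀ a ∈ A, a ≠ 0) (hAC : ∀ a ∈ A, x + a ∈ C) {N : ℝ} (hN : 0 < N) :
    ∃ f : StrongDual ℝ E, (∀ c ∈ C, f x - 1 < f c) ∧ ∀ a ∈ A, N < f a := by
  set D := (x + ·) '' A with hD
  have hDC : D ⊆ C := by rintro _ ⟨a, ha, rfl⟩; exact hAC a ha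
  have hxD : x ∉ D := by
    rintro ⟨a, ha, h⟩
    exact hA0 a ha (by simpa using h)
  -- Reflect the hull of `x + A` through `x` and shrink it by `N`. The image misses `C`, since
  -- otherwise `x` would lie inside a segment of `C`. Separating the two gives `f a > N * (f x -
  -- v)`.
  set φ : E →ᵃ[ℝ] E := AffineMap.homothety x (-(1 / N)) with hφ
  have hφ' : ∀ p, φ p = -(1 / N) • (p - x) + x := fun p => by simp [hφ, AffineMap.homothety_apply]
  have hKc : IsCompact (φ '' convexHull ℝ D) :=
    ((hA.image _).isCompact_convexHull ℝ).image (by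
      have : (φ : E → E) = fun p => -(1 / N) • (p - x) + x := funext hφ'
      rw [this]; fun_prop)
  have hdisj : Disjoint (φ '' convexHull ℝ D) C := by
    rw [Set.disjoint_left]
    rintro _ ⟨p, hp, rfl⟩ hpC
    have hpx : p = x := by
      refine hx.2 (convexHull_min hDC hC hp) hpC ⟨1 / (1 + N), N / (1 + N), by positivity,
        by positivity, by field_simp, ?_⟩
      rw [hφ', smul_add, smul_smul, smul_sub]
      have e1 : N / (1 + N) * -(1 / N) = -(1 / (1 + N)) := by field_simp
      have e2 : N / (1 + N) = 1 - 1 / (1 + N) := by field_simp; ring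
      rw [e1, e2]
      module
    exact notMem_convexHull_of_mem_extremePoints hC hx hDC hxD (hpx ▸ hp)
  obtain ⟨f, u, v, hu, huv, hv⟩ := geometric_hahn_banach_compact_closed
    ((convex_convexHull ℝ D).affine_image φ) hKc hC hCc hdisj
  have hκ : 0 < f x - v := by linarith [hv x hx.1]
  refine ⟨(f x - v)⁻¹ • f, fun c hc => ?_, fun a ha => ?_⟩
  · have h1 := hv c hc
    simp only [FunLike.coe_smul, Pi.smul_apply, smul_eq_mul]
    have h2 : (f x - v)⁻¹ * (f x - v) = 1 := inv_mul_cancel₀ hκ.ne'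
    have h3 := mul_lt_mul_of_pos_left h1 (inv_pos.2 hκ)
    linarith
  · have h1 := hu _ ⟨x + a, subset_convexHull ℝ D ⟨a, ha, rfl⟩, rfl⟩
    rw [hφ', add_sub_cancel_left, map_add, map_smul, smul_eq_mul] at h1
    simp only [FunLike.coe_smul, Pi.smul_apply, smul_eq_mul]
    have h2 : f x - v < 1 / N * f a := by linarith
    rw [inv_mul_eq_div, lt_div_iff₀ hκ]
    have h3 := mul_lt_mul_of_pos_left h2 hN
    have h4 : N * (1 / N * f a) = f a := by field_simp
    linarith

theorem eventually_quadratic_ne_zero (a b : ℝ) {c : ℝ} (hc : c ≠ 0) :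
    ∀ᶠ ε in 𝓝[>] (0 : ℝ), a + ε * b + ε ^ 2 * c ≠ 0 := by
  have key : ∀ {g : ℝ → ℝ}, Continuous g → g 0 ≠ 0 → ∀ᶠ ε in 𝓝[>] (0 : ℝ), g ε ≠ 0 :=
    fun hg h0 => (hg.continuousAt.eventually_ne h0).filter_mono nhdsWithin_le_nhds
  by_cases ha : a = 0
  · have h1 : ∀ᶠ ε in 𝓝[>] (0 : ℝ), b + ε * c ≠ 0 := by
      by_cases hb : b = 0
      · filter_upwards [self_mem_nhdsWithin] with ε hε
        simpa [hb] using ⟨(mem_Ioi.1 hε).ne', hc⟩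
      · exact key (by fun_prop) (by simpa using hb)
    filter_upwards [h1, self_mem_nhdsWithin] with ε h2 hε
    have : a + ε * b + ε ^ 2 * c = ε * (b + ε * c) := by rw [ha]; ring
    rw [this]
    exact mul_ne_zero (mem_Ioi.1 hε).ne' h2
  · exact key (by fun_prop) (by simpa using ha)

/-- The functional of `exists_strongDual_steep` can be chosen not to vanish on finitely many given
nonzero vectors. -/
theorem exists_strongDual_steep_generic [FiniteDimensional ℝ E] {C : Set E} {x : E}
    (hC : Convex ℝ C) (hCc : IsClosed C) (hx : x ∈ extremePoints ℝ C) {A : Set E} (hA : A.Finite)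
    (hA0 : ∀ a ∈ A, a ≠ 0) (hAC : ∀ a ∈ A, x + a ∈ C) {N : ℝ} (hN : 0 < N)
    {W : Set E} (hW : W.Finite) (hW0 : ∀ w ∈ W, w ≠ 0) :
    ∃ f : StrongDual ℝ E, (∀ c ∈ C, f x - 2 ≤ f c) ∧ (∀ a ∈ A, N < f a) ∧ ∀ w ∈ W, f w ≠ 0 := by
  obtain ⟨f₀, h₀C, h₀A⟩ := exists_strongDual_steep hC hCc hx hA hA0 hAC hN
  obtain ⟨f₁, δ, hδ, h₁⟩ := exists_strongDual_slice hC hCc hx one_pos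
  obtain ⟨l', hl'⟩ : ∃ l : Module.Dual ℝ E, ∀ w : W, l w ≠ 0 := by
    have := hW.to_subtype
    exact Module.exists_dual_forall_apply_ne_zero (fun w : W => (w : E)) fun w => hW0 w w.2
  set l : StrongDual ℝ E := LinearMap.toContinuousLinearMap l' with hl
  have hlW : ∀ w ∈ W, l w ≠ 0 := fun w hw => hl' ⟨w, hw⟩
  have small : ∀ {g : ℝ → ℝ} {b : ℝ}, Continuous g → g 0 < b → ∀ᶠ ε in 𝓝[>] (0 : ℝ), g ε < b :=
    fun hg h0 => (hg.continuousAt.eventually_lt continuousAt_const h0).filter_mono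
      nhdsWithin_le_nhds
  have ev1 : ∀ᶠ ε in 𝓝[>] (0 : ℝ), ε * ‖l‖ < δ := small (by fun_prop) (by simpa using hδ)
  have ev2 : ∀ᶠ ε in 𝓝[>] (0 : ℝ), ε * (‖f₁‖ + ε * ‖l‖) < 1 := small (by fun_prop) (by simp)
  have ev3 : ∀ᶠ ε in 𝓝[>] (0 : ℝ), ∀ a ∈ A, N < f₀ a + ε * f₁ a + ε ^ 2 * l a := by
    refine (eventually_all_finite hA).2 fun a ha => ?_
    have : ∀ᶠ ε in 𝓝[>] (0 : ℝ), -(f₀ a + ε * f₁ a + ε ^ 2 * l a) < -N :=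
      small (by fun_prop) (by simpa using h₀A a ha)
    filter_upwards [this] with ε h
    linarith
  have ev4 : ∀ᶠ ε in 𝓝[>] (0 : ℝ), ∀ w ∈ W, f₀ w + ε * f₁ w + ε ^ 2 * l w ≠ 0 :=
    (eventually_all_finite hW).2 fun w hw => eventually_quadratic_ne_zero _ _ (hlW w hw)
  have ev5 : ∀ᶠ ε in 𝓝[>] (0 : ℝ), 0 < ε := self_mem_nhdsWithin
  -- On unbounded `C`, perturbing `f₀` by `l` alone could destroy the lower bound. The gap of `f₁`
  -- on the unit sphere about `x` absorbs `ε • l`, so `f₁ + ε • l` stays bounded below.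
  obtain ⟨ε, e1, e2, e3, e4, e5⟩ := (ev1.and (ev2.and (ev3.and (ev4.and ev5)))).exists
  have happ : ∀ y, (f₀ + ε • f₁ + ε ^ 2 • l) y = f₀ y + ε * f₁ y + ε ^ 2 * l y := fun y => by
    simp
  refine ⟨f₀ + ε • f₁ + ε ^ 2 • l, fun c hc => ?_, fun a ha => (happ a).symm ▸ e3 a ha,
    fun w hw => (happ w).symm ▸ e4 w hw⟩
  set h : StrongDual ℝ E := f₁ + ε • l with hh
  have happ' : ∀ y, (f₀ + ε • f₁ + ε ^ 2 • l) y = f₀ y + ε * h y := fun y => by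
    simp [hh]; ring
  have hlow : -1 ≤ ε * (h c - h x) := by
    rcases le_or_gt 1 ‖c - x‖ with hcx | hcx
    · have h2 : h x + 0 ≤ h c := by
        refine hC.le_of_le_on_sphere hx.1 h one_pos le_rfl (fun d hd hdx => ?_) hc hcx
        have h3 := h₁ d hd hdx.ge
        have h4 := (abs_le.1 ((Real.norm_eq_abs _ ▸ l.le_opNorm (d - x)))).1
        rw [hdx, mul_one, map_sub] at h4
        have h5 := mul_le_mul_of_nonneg_left h4 e5.le
        have h6 : ∀ y, h y = f₁ y + ε * l y := fun y => by simp [hh]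
        rw [h6, h6]
        linarith
      have := mul_nonneg e5.le (show 0 ≤ h c - h x by linarith)
      linarith
    · have h2 := (abs_le.1 ((Real.norm_eq_abs _ ▸ h.le_opNorm (c - x)))).1
      rw [map_sub] at h2
      have h3 : ‖h‖ ≤ ‖f₁‖ + ε * ‖l‖ := by
        refine (norm_add_le _ _).trans ?_
        rw [norm_smul, Real.norm_of_nonneg e5.le]
      have h4 : ‖h‖ * ‖c - x‖ ≤ (‖f₁‖ + ε * ‖l‖) * 1 := by gcongr
      have h5 : -(‖f₁‖ + ε * ‖l‖) ≤ h c - h x := by linarith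
      have h6 := mul_le_mul_of_nonneg_left h5 e5.le
      linarith
  rw [happ', happ']
  linarith [h₀C c hc]

end ExtremePoints

/-! ### Sums of admissible steps at an extreme point. -/

section ExtremePointSums

open Set

/-- Let `x` be an extreme point of the closed convex hull `C` of a closed set `T`, and let `a i` be
finitely many nonzero, pairwise nonparallel vectors such that `x + a i ∈ C` and such that `T`
contains with every `t` one of `t ± a i`. Then `C` contains the sum of `x` and all the `a i`. -/
theorem add_sum_mem_closure_convexHull {E ι : Type*} [NormedAddCommGroup E] [NormedSpace ℝ E]
    [FiniteDimensional ℝ E] {T : Set E} (hT : IsClosed T) {x : E}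
    (hx : x ∈ extremePoints ℝ (closure (convexHull ℝ T))) (a : ι → E) (S : Finset ι)
    (ha0 : ∀ i ∈ S, a i ≠ 0) (haC : ∀ i ∈ S, x + a i ∈ closure (convexHull ℝ T))
    (haT : ∀ t ∈ T, ∀ i ∈ S, t + a i ∈ T ∨ t - a i ∈ T)
    (hpar : ∀ i ∈ S, ∀ j ∈ S, i ≠ j → ∀ r : ℝ, a i ≠ r • a j) :
    x + ∑ i ∈ S, a i ∈ closure (convexHull ℝ T) := by
  classical
  have hxT := extremePoints_closure_convexHull_subset hT hx
  have hTC : T ⊆ closure (convexHull ℝ T) := (subset_convexHull ℝ T).trans subset_closure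
  by_contra hnot
  obtain ⟨g, u, hg, hu⟩ := geometric_hahn_banach_closed_point
    (convex_convexHull ℝ T).closure isClosed_closure hnot
  set I := S.filter fun i => 0 < g (a i) with hI
  have hIS : ∀ i ∈ I, i ∈ S := fun i hi => (Finset.mem_filter.1 hi).1
  have hIpos : ∀ i ∈ I, 0 < g (a i) := fun i hi => (Finset.mem_filter.1 hi).2
  have hsum : ∑ i ∈ S, g (a i) ≤ ∑ i ∈ I, g (a i) := by
    rw [hI, Finset.sum_filter]
    refine Finset.sum_le_sum fun i _ => ?_
    split_ifs with h
    · exact le_rfl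
    · exact not_lt.1 h
  rw [map_add, map_sum] at hu
  set Δ := ∑ i ∈ I, g (a i) - (u - g x) with hΔ
  have hΔ0 : 0 < Δ := by linarith
  -- With `B = 2` the planar error `B / c` is `Δ / 2`, less than the excess `Δ`.
  set c := 4 / Δ with hc
  have hc0 : 0 < c := by positivity
  have hG0 : 0 ≤ ∑ i ∈ I, g (a i) := Finset.sum_nonneg fun i hi => (hIpos i hi).le
  have hN : 0 < c * ∑ i ∈ I, g (a i) + 1 := by positivity
  -- `f` kills `w (i, j)` exactly when the slopes of `i` and `j` coincide.
  set w : ι × ι → E := fun q => g (a q.2) • a q.1 - g (a q.1) • a q.2 with hw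
  obtain ⟨f, hfC, hfA, hfW⟩ := exists_strongDual_steep_generic (convex_convexHull ℝ T).closure
    isClosed_closure hx (I.finite_toSet.image a)
    (by rintro _ ⟨i, hi, rfl⟩; exact ha0 i (hIS i hi))
    (by rintro _ ⟨i, hi, rfl⟩; exact haC i (hIS i hi)) hN
    (I.offDiag.finite_toSet.image w)
    (by
      rintro _ ⟨⟨i, j⟩, hij, rfl⟩ h0
      obtain ⟨hi, hj, hne⟩ := Finset.mem_offDiag.1 (Finset.mem_coe.1 hij)
      refine hpar i (hIS i hi) j (hIS j hj) hne (g (a i) / g (a j)) ?_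
      have h1 : g (a j) • a i = g (a i) • a j := sub_eq_zero.1 h0
      rw [div_eq_inv_mul, mul_smul, ← h1, smul_smul, inv_mul_cancel₀ (hIpos j hj).ne', one_smul])
  have key := sum_le_of_forall_add_mem_or_sub_mem
    (P := (fun t => (f t - f x, g t - g x)) '' T) ⟨x, hxT, by simp⟩ (B := 2) (M := u - g x) (c := c)
    (by rintro _ ⟨t, ht, rfl⟩; have := hfC t (hTC ht); dsimp only; linarith)
    (by rintro _ ⟨t, ht, rfl⟩; have := hg t (hTC ht); dsimp only; linarith)
    hc0 (fun i => f (a i)) (fun i => g (a i)) I hIpos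
    (fun i hi => by
      rw [lt_div_iff₀ (hIpos i hi)]
      have h1 := hfA _ ⟨i, hi, rfl⟩
      have h2 := mul_le_mul_of_nonneg_left
        (Finset.single_le_sum (fun j hj => (hIpos j hj).le) hi) hc0.le
      linarith)
    (fun i hi j hj hij => by
      by_contra hne
      refine hfW _ ⟨(i, j), Finset.mem_coe.2 (Finset.mem_offDiag.2 ⟨hi, hj, hne⟩), rfl⟩ ?_
      have h1 := (div_eq_div_iff (hIpos i hi).ne' (hIpos j hj).ne').1 hij
      simp only [hw, map_sub, map_smul, smul_eq_mul]
      linear_combination h1)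
    (by
      rintro _ ⟨t, ht, rfl⟩ i hi
      rcases haT t ht i (hIS i hi) with h | h
      · exact Or.inl ⟨_, h, by simp only [map_add, Prod.mk_add_mk]; congr 1 <;> ring⟩
      · exact Or.inr ⟨_, h, by simp only [map_sub, Prod.mk_sub_mk]; congr 1 <;> ring⟩)
  have h1 : 2 / c = Δ / 2 := by
    rw [hc]
    field_simp
    norm_num
  linarith

end ExtremePointSums

/-! ### Choice of signs and of the translate. -/

theorem theorem2 {n : ℕ}
    (V : Finset (EuclideanSpace ℝ (Fin n)))
    (hV : ∀ u ∈ V, ∀ v ∈ V, u ≠ v → ¬ VClosed.Parallel u v)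
    (T : Set (EuclideanSpace ℝ (Fin n)))
    (hT : IsClosed T)
    (hVT : VClosed.IsVClosed V T)
    (x : EuclideanSpace ℝ (Fin n))
    (hx : x ∈ Set.extremePoints ℝ (closure (convexHull ℝ T))) :
    ∃ t : EuclideanSpace ℝ (Fin n),
      x ∈ VClosed.translate t (VClosed.subsetSums V) ∧
        VClosed.translate t (VClosed.subsetSums V) ⊆ closure (convexHull ℝ T) := by
  classical
  have hxT := extremePoints_closure_convexHull_subset hT hx
  have hTC : T ⊆ closure (convexHull ℝ T) := (subset_convexHull ℝ T).trans subset_closure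
  set C := closure (convexHull ℝ T) with hC
  set a : EuclideanSpace ℝ (Fin n) → EuclideanSpace ℝ (Fin n) :=
    fun v => if x + v ∈ C then v else -v with ha
  have ha_or : ∀ v, a v = v ∨ a v = -v := fun v => by
    by_cases h : x + v ∈ C <;> simp [ha, h]
  have haC : ∀ v ∈ V, x + a v ∈ C := fun v hv => by
    by_cases h : x + v ∈ C
    · simp [ha, h]
    · have h1 : x - v ∈ C := (hVT x hxT v hv).elim (fun h' => absurd (hTC h') h) fun h' => hTC h'
      simpa [ha, h, ← sub_eq_add_neg] using h1
  refine ⟨x - ∑ v ∈ V with x + v ∉ C, v,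
    ⟨_, ⟨V.filter (fun v => x + v ∉ C), Finset.filter_subset _ _, rfl⟩, sub_add_cancel _ _⟩, ?_⟩
  rintro _ ⟨_, ⟨W, hWV, rfl⟩, rfl⟩
  -- If `x + v ∈ C`, then `v` contributes `v` when chosen in `W`; otherwise it contributes `-v` when
  -- not chosen. The zero vector may belong to `V` and is dropped.
  have hsum : x - ∑ v ∈ V with x + v ∉ C, v + ∑ v ∈ W, v =
      x + ∑ v ∈ V with v ≠ 0 ∧ (v ∈ W ↔ x + v ∈ C), a v := by
    have hW : ∑ v ∈ W, v = ∑ v ∈ V, if v ∈ W then v else 0 := by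
      rw [← Finset.sum_filter, Finset.filter_mem_eq_inter, Finset.inter_eq_right.2 hWV]
    rw [hW, sub_add_eq_add_sub, add_sub_assoc, Finset.sum_filter, Finset.sum_filter,
      ← Finset.sum_sub_distrib]
    congr 1
    refine Finset.sum_congr rfl fun v _ => ?_
    by_cases h0 : v = 0 <;> by_cases h1 : v ∈ W <;> by_cases h2 : x + v ∈ C <;>
      simp [ha, h0, h1, h2]
  dsimp only
  rw [hsum]
  refine add_sum_mem_closure_convexHull hT hx a _ (fun v hv => ?_) (fun v hv => ?_)
    (fun t ht v hv => ?_) (fun v hv w hw hvw r hr => ?_)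
  · obtain ⟨-, h0, -⟩ := Finset.mem_filter.1 hv
    rcases ha_or v with h | h <;> simpa [h] using h0
  · exact haC v (Finset.mem_filter.1 hv).1
  · rcases ha_or v with h | h <;> rw [h]
    · exact hVT t ht v (Finset.mem_filter.1 hv).1
    · rw [← sub_eq_add_neg, sub_neg_eq_add]
      exact (hVT t ht v (Finset.mem_filter.1 hv).1).symm
  · obtain ⟨hvV, hv0, -⟩ := Finset.mem_filter.1 hv
    obtain ⟨hwV, -, -⟩ := Finset.mem_filter.1 hw
    obtain ⟨s, hs⟩ : ∃ s : ℝ, v = s • w := by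
      rcases ha_or v with h | h <;> rcases ha_or w with h' | h' <;> rw [h, h'] at hr
      · exact ⟨r, hr⟩
      · exact ⟨-r, by rw [hr, smul_neg, neg_smul]⟩
      · exact ⟨-r, by rw [neg_smul, ← hr, neg_neg]⟩
      · exact ⟨r, by simpa using hr⟩
    exact hV v hvV w hwV hvw ⟨s, fun h => hv0 (by simp [hs, h]), hs⟩
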